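/- Let $r\ge 2$ and let $G_1,\dots,G_r$ be finite connected simple graphs with vertex sets $V_i$, $|V_i|\ge 2$, and roots $o_i\in V_i$. Their free product $G=G_1*\dots*G_r$ is the graph whose vertices are the finite words $x_1\cdots x_n$ ($n\ge 0$), each letter taken from the disjoint union of the sets $V_i\setminus\{o_i\}$, with no two consecutive letters from the same $V_i$; its root $o$ is the empty word. Its edges are the pairs $\{wx,wy\}$, where $x,y$ are adjacent in some $G_i$ and $w$ is a word that does not end in a letter of $V_i$ (with $wo_i:=w$). Let $\sigma_n$ be the number of self-avoiding walks of length $n$ in $G$ that start at $o$, let $\sigma_n^{(i)}$ be the number of those in $G_i$ that start at $o_i$, and put $\mathcal M_i(z)=\sum_{n\ge1}\sigma_n^{(i)}z^n$. Then every $\mathcal M_i$ is a polynomial with integer coefficients, the connective constant $\mu=\lim_{n\to\infty}\sigma_n^{1/n}$ exists, the integer polynomial $$D(z)=\prod_{k=1}^r\bigl(1+\mathcal M_k(z)\bigr)-\sum_{i=1}^r\mathcal M_i(z)\prod_{j\ne i}\bigl(1+\mathcal M_j(z)\bigr)$$ has a smallest positive real zero $z_*$, and $\mu=1/z_*$. In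 particular, $\mu$ is an algebraic number. -/

import Mathlib

/-- A letter of the free product of the rooted sets `(V i, o i)`: an index `i` together with an
element of `V i` other than the root `o i`. Using a sigma type makes the vertex sets disjoint. -/
abbrev FreeLetter {ι : Type*} (V : ι → Type*) (o : ∀ i, V i) : Type _ :=
  Σ i, {x : V i // x ≠ o i}

/-- The vertex set of the free product: finite words of letters (the empty word included) in which
no two consecutive letters have the same index. -/
abbrev FreeWord {ι : Type*} (V : ι → Type*) (o : ∀ i, V i) : Type _ :=
  {w : List (FreeLetter V o) // w.IsChain (fun a b => a.1 ≠ b.1)}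

/-- The empty word, which is the root of the free product. -/
def FreeWord.root {ι : Type*} (V : ι → Type*) (o : ∀ i, V i) : FreeWord V o :=
  ⟨[], List.IsChain.nil⟩

open Classical in
/-- An element of `V i` as a word: the root `o i` is identified with the empty word, any other
element with the corresponding one-letter word. -/
noncomputable def vertexWord {ι : Type*} {V : ι → Type*} (o : ∀ i, V i) {i : ι} (x : V i) :
    List (FreeLetter V o) :=
  if h : x = o i then [] else [⟨i, ⟨x, h⟩⟩]

theorem vertexWord_injective {ι : Type*} {V : ι → Type*} (o : ∀ i, V i) {i : ι} {x y : V i}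
    (h : vertexWord o x = vertexWord o y) : x = y := by
  unfold vertexWord at h
  split_ifs at h with hx hy hy
  · exact hx.trans hy.symm
  · simpa using h

/-- The free product of the rooted graphs `(G i, o i)`: for every word `w` that does not end in a
letter of index `i` and all adjacent `x`, `y` in `G i`, the words `wx` and `wy` are adjacent. -/
def freeProductGraph {ι : Type*} {V : ι → Type*} (G : ∀ i, SimpleGraph (V i)) (o : ∀ i, V i) :
    SimpleGraph (FreeWord V o) where
  Adj a b := ∃ (i : ι) (w : FreeWord V o) (x y : V i),
    (∀ l ∈ w.1.getLast?, l.1 ≠ i) ∧ (G i).Adj x y ∧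
      a.1 = w.1 ++ vertexWord o x ∧ b.1 = w.1 ++ vertexWord o y
  symm := ⟨by
    rintro a b ⟨i, w, x, y, hw, hxy, ha, hb⟩
    exact ⟨i, w, y, x, hw, hxy.symm, hb, ha⟩⟩
  loopless := ⟨by
    rintro a ⟨i, w, x, y, -, hxy, ha, hb⟩
    exact hxy.ne (vertexWord_injective o (List.append_cancel_left (ha.symm.trans hb)))⟩

/-- The number of self-avoiding walks of length `n` on `G` that start at `o`, with any end point
(`SimpleGraph.Walk.IsPath` says that no vertex is repeated). -/
noncomputable def sawCount {V : Type*} (G : SimpleGraph V) (o : V) (n : ℕ) : ℕ :=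
  Nat.card {p : Σ v : V, G.Walk o v // p.2.IsPath ∧ p.2.length = n}

/-- `μ` is the connective constant of the rooted graph `(G, o)`: the limit exists and equals `μ`. -/
def IsConnectiveConstant {V : Type*} (G : SimpleGraph V) (o : V) (μ : ℝ) : Prop :=
  Filter.Tendsto (fun n : ℕ => (sawCount G o n : ℝ) ^ ((1 : ℝ) / (n : ℝ))) Filter.atTop (nhds μ)

/-- The generating function `∑_{n ≥ 1} σ_n zⁿ` of the self-avoiding walks of positive length. -/
noncomputable def sawSeries {V : Type*} (G : SimpleGraph V) (o : V) : PowerSeries ℤ :=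
  PowerSeries.mk fun n => if n = 0 then 0 else (sawCount G o n : ℤ)

/-- The polynomial `∏_k (1 + M_k) - ∑_i M_i ∏_{j ≠ i} (1 + M_j)`. -/
noncomputable def denomPoly {ι : Type*} [Fintype ι] [DecidableEq ι] (M : ι → Polynomial ℤ) :
    Polynomial ℤ :=
  ∏ k, (1 + M k) - ∑ i, M i * ∏ j ∈ Finset.univ.erase i, (1 + M j)

/-! Every copy of a factor `G i` hangs on the rest of the free product at a cut vertex, so a
self-avoiding walk that leaves a copy through one of its vertices never returns. A walk from the
root that starts in `G i` is therefore, in a unique way, a nonempty self-avoiding walk of `G i`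
followed by a self-avoiding walk, shifted into the cone of the vertex reached, that does not start
in `G i` (`sawListsFrom_eq_image`, `injOn_joinSaw`). If `A i` and `S` are the generating functions
of the walks that start in `G i` and of all walks, then `A i = M i * (S - A i)` and `S = 1 + ∑ A i`,
hence formally `S = 1 / (1 - ∑ M i / (1 + M i))`.

No singularity analysis is needed. At a point `z` in `(0, 1]` with `∑ M i / (1 + M i) = 1`, the
numbers `u i = M i / (1 + M i)` are a stationary solution of the recurrence rescaled by `z ^ n`.
Induction compares the counts with multiples of `u` from above and below
(`IsRenewalSystem.exists_bounds`), so `σ n * z ^ n` lies between positive constants and the `n`-th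
roots tend to `1 / z`.

The polynomial `D` is `∏ (1 + M i)` times `1 - ∑ M i / (1 + M i)`. On `[0, ∞)` the product does not
vanish and the sum is strictly increasing, so that `z` is the smallest positive zero
(`exists_isLeast_denomPoly`). -/

/-! ### Self-avoiding walks as vertex lists -/

/-- The vertex lists, without the starting point `o`, of the self-avoiding walks of length `n` from
`o` for the adjacency relation `R`. -/
def sawLists {α : Type*} (R : α → α → Prop) (o : α) (n : ℕ) : Set (List α) :=
  {t | t.length = n ∧ (o :: t).IsChain R ∧ (o :: t).Nodup}

theorem exists_walk_support_eq {α : Type*} (G : SimpleGraph α) (t : List α) :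
    ∀ o : α, (o :: t).IsChain G.Adj → ∃ (v : α) (p : G.Walk o v), p.support = o :: t := by
  induction t with
  | nil => exact fun o _ => ⟨o, .nil, rfl⟩
  | cons a t ih =>
    intro o h
    obtain ⟨hoa, ht⟩ := List.isChain_cons_cons.1 h
    obtain ⟨v, p, hp⟩ := ih a ht
    exact ⟨v, .cons hoa p, by simp [hp]⟩

/-- A walk in a simple graph is determined by its support. Lists avoid the dependence of the walk
type on the end point. -/
theorem sawCount_eq_ncard {α : Type*} (G : SimpleGraph α) (o : α) (n : ℕ) :
    sawCount G o n = (sawLists G.Adj o n).ncard := by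
  unfold sawCount
  rw [← Nat.card_coe_set_eq]
  refine Nat.card_eq_of_bijective (fun p => ⟨p.1.2.support.tail, ?_⟩) ⟨?_, ?_⟩
  · obtain ⟨⟨v, p⟩, hp, hn⟩ := p
    refine ⟨by simp [hn], ?_, ?_⟩
    · rw [p.cons_tail_support]; exact p.isChain_adj_support
    · rw [p.cons_tail_support]; exact hp.support_nodup
  · rintro ⟨⟨v, p⟩, hp, hn⟩ ⟨⟨v', p'⟩, hp', hn'⟩ h
    have h1 : p.support = p'.support := by
      rw [← p.cons_tail_support, ← p'.cons_tail_support]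
      exact congrArg _ (Subtype.ext_iff.1 h)
    have h2 : v = v' := by
      rw [← p.getLast_support, ← p'.getLast_support]
      simp only [h1]
    subst h2
    obtain rfl := SimpleGraph.Walk.ext_support h1
    rfl
  · rintro ⟨t, hn, hc, hd⟩
    obtain ⟨v, p, hp⟩ := exists_walk_support_eq G t o hc
    refine ⟨⟨⟨v, p⟩, ?_, ?_⟩, ?_⟩
    · rw [SimpleGraph.Walk.isPath_def, hp]; exact hd
    · have := p.length_support
      rw [hp, List.length_cons, hn] at this
      simpa using this.symm
    · simp [hp]

theorem sawLists_zero {α : Type*} (R : α → α → Prop) (o : α) : sawLists R o 0 = {[]} := by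
  ext t
  simp only [sawLists, Set.mem_ofPred_eq, List.length_eq_zero_iff, Set.mem_singleton_iff]
  exact ⟨fun h => h.1, by rintro rfl; simp⟩

theorem sawLists_finite {α : Type*} [Finite α] (R : α → α → Prop) (o : α) (n : ℕ) :
    (sawLists R o n).Finite :=
  (List.finite_length_eq α n).subset fun _ h => h.1

/-! ### Words, edges and cones in the free product -/

section FreeWords

variable {ι : Type*} {V : ι → Type*} (o : ∀ i, V i)

theorem vertexWord_self (i : ι) : vertexWord o (o i) = [] := by simp [vertexWord]

theorem vertexWord_of_ne {i : ι} {x : V i} (h : x ≠ o i) :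
    vertexWord o x = [⟨i, ⟨x, h⟩⟩] := by simp [vertexWord, h]

theorem vertexWord_eq_nil {i : ι} {x : V i} : vertexWord o x = [] ↔ x = o i := by
  by_cases h : x = o i <;> simp [vertexWord, h]

theorem length_vertexWord_le {i : ι} (x : V i) : (vertexWord o x).length ≤ 1 := by
  by_cases h : x = o i <;> simp [vertexWord, h]

theorem fst_eq_of_mem_vertexWord {i : ι} {x : V i} {l : FreeLetter V o}
    (h : l ∈ vertexWord o x) : l.1 = i := by
  by_cases hx : x = o i
  · simp [vertexWord, hx] at h
  · rw [vertexWord_of_ne o hx, List.mem_singleton] at h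
    rw [h]

variable {o}

/-- Adjacency in the free product, as a relation on arbitrary words. -/
def wordAdj (G : ∀ i, SimpleGraph (V i)) (o : ∀ i, V i) (a b : List (FreeLetter V o)) : Prop :=
  ∃ (i : ι) (w : List (FreeLetter V o)) (x y : V i), w.IsChain (fun a b => a.1 ≠ b.1) ∧
    (∀ l ∈ w.getLast?, l.1 ≠ i) ∧ (G i).Adj x y ∧
      a = w ++ vertexWord o x ∧ b = w ++ vertexWord o y

variable {G : ∀ i, SimpleGraph (V i)}

theorem freeProductGraph_adj_iff {a b : FreeWord V o} :
    (freeProductGraph G o).Adj a b ↔ wordAdj G o a.1 b.1 := by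
  constructor
  · rintro ⟨i, w, x, y, h⟩
    exact ⟨i, w.1, x, y, w.2, h⟩
  · rintro ⟨i, w, x, y, hw, h⟩
    exact ⟨i, ⟨w, hw⟩, x, y, h⟩

theorem isChain_append_vertexWord {i : ι} {w : List (FreeLetter V o)} (x : V i)
    (hw : w.IsChain (fun a b => a.1 ≠ b.1)) (h : ∀ l ∈ w.getLast?, l.1 ≠ i) :
    (w ++ vertexWord o x).IsChain (fun a b => a.1 ≠ b.1) := by
  refine List.isChain_append.2 ⟨hw, ?_, fun l hl k hk => ?_⟩
  · by_cases hx : x = o i <;> simp [vertexWord, hx]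
  · rw [fst_eq_of_mem_vertexWord o (List.mem_of_mem_head? hk)]
    exact h l hl

theorem wordAdj.isChain_right {a b : List (FreeLetter V o)} (h : wordAdj G o a b) :
    b.IsChain (fun a b => a.1 ≠ b.1) := by
  obtain ⟨i, w, x, y, hw, hl, -, -, rfl⟩ := h
  exact isChain_append_vertexWord y hw hl

theorem wordAdj_vertexWord {i : ι} {x y : V i} (h : (G i).Adj x y) :
    wordAdj G o (vertexWord o x) (vertexWord o y) :=
  ⟨i, [], x, y, List.IsChain.nil, by simp, h, by simp, by simp⟩

/-- Shifting an edge into the cone of `l` requires that `l` may precede both of its end points. -/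
theorem wordAdj.cons {l : FreeLetter V o} {a b : List (FreeLetter V o)} (h : wordAdj G o a b)
    (ha : ∀ k ∈ a.head?, l.1 ≠ k.1) (hb : ∀ k ∈ b.head?, l.1 ≠ k.1) :
    wordAdj G o (l :: a) (l :: b) := by
  obtain ⟨i, w, x, y, hw, hl, hxy, rfl, rfl⟩ := h
  refine ⟨i, l :: w, x, y, List.isChain_cons.2 ⟨?_, hw⟩, ?_, hxy, by simp, by simp⟩
  · intro k hk
    exact ha k (by cases w <;> simp_all)
  · cases w with
    | cons c w => simpa using hl
    | nil =>
      rintro k hk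
      -- Here the edge lies in a copy at the root. Its ends are not both the root, so one of them is
      -- a letter of index `i`, which forces `l.1 ≠ i`.
      obtain rfl : l = k := by simpa using hk
      by_cases hx : x = o i
      · have hy : y ≠ o i := fun hy => hxy.ne (hx.trans hy.symm)
        exact hb ⟨i, ⟨y, hy⟩⟩ (by simp [vertexWord_of_ne o hy])
      · exact ha ⟨i, ⟨x, hx⟩⟩ (by simp [vertexWord_of_ne o hx])

/-- The case split behind the cut-vertex argument: an edge lies in a copy of a factor at the root,
or within the cone of a single letter. -/
theorem wordAdj.cases {a b : List (FreeLetter V o)} (h : wordAdj G o a b) :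
    (∃ (i : ι) (x y : V i), (G i).Adj x y ∧ a = vertexWord o x ∧ b = vertexWord o y) ∨
    ∃ (l : FreeLetter V o) (a' b' : List (FreeLetter V o)), a = l :: a' ∧ b = l :: b' ∧
      wordAdj G o a' b' ∧ ∀ k ∈ b'.head?, l.1 ≠ k.1 := by
  obtain ⟨i, w, x, y, hw, hl, hxy, rfl, rfl⟩ := h
  cases w with
  | nil => exact Or.inl ⟨i, x, y, hxy, by simp, by simp⟩
  | cons l w =>
    refine Or.inr ⟨l, w ++ vertexWord o x, w ++ vertexWord o y, by simp, by simp,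
      ⟨i, w, x, y, hw.of_cons, ?_, hxy, rfl, rfl⟩, ?_⟩
    · cases w with
      | nil => simp
      | cons c w => simpa using hl
    · have := isChain_append_vertexWord y hw hl
      rw [List.cons_append] at this
      exact (List.isChain_cons.1 this).1

theorem wordAdj.ne {a b : List (FreeLetter V o)} (h : wordAdj G o a b) : a ≠ b := by
  obtain ⟨i, w, x, y, -, -, hxy, rfl, rfl⟩ := h
  exact fun h => hxy.ne (vertexWord_injective o (List.append_cancel_left h))

/-- Self-avoiding walks in the free product can be counted as lists of words. -/
theorem sawCount_freeProductGraph (n : ℕ) :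
    sawCount (freeProductGraph G o) (FreeWord.root V o) n = (sawLists (wordAdj G o) [] n).ncard := by
  rw [sawCount_eq_ncard]
  have hinj : Function.Injective (List.map (Subtype.val : FreeWord V o → _)) :=
    List.map_injective_iff.2 Subtype.val_injective
  rw [← Set.ncard_image_of_injective _ hinj]
  congr 1
  have key : ∀ t : List (FreeWord V o), t.map Subtype.val ∈ sawLists (wordAdj G o) [] n ↔
      t ∈ sawLists (freeProductGraph G o).Adj (FreeWord.root V o) n := by
    intro t
    have h0 : ([] : List (FreeLetter V o)) :: t.map Subtype.val =
      (FreeWord.root V o :: t).map Subtype.val := rfl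
    have h1 : (freeProductGraph G o).Adj = fun a b => wordAdj G o a.1 b.1 := by
      ext a b; exact freeProductGraph_adj_iff
    simp only [sawLists, Set.mem_ofPred_eq, h0, List.length_map, List.isChain_map,
      List.nodup_map_iff Subtype.val_injective, h1]
  have hval : ∀ (t : List (List (FreeLetter V o))) (a : List (FreeLetter V o)),
      (a :: t).IsChain (wordAdj G o) → ∀ w ∈ t, w.IsChain (fun a b => a.1 ≠ b.1) := by
    intro t
    induction t with
    | nil => simp
    | cons b t ih =>
      intro a h
      obtain ⟨hab, ht⟩ := List.isChain_cons_cons.1 h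
      intro w hw
      rcases List.mem_cons.1 hw with rfl | hw
      · exact hab.isChain_right
      · exact ih b ht w hw
  ext t
  constructor
  · rintro ⟨t, ht, rfl⟩
    exact (key t).2 ht
  · intro ht
    refine ⟨t.attach.map fun w => ⟨w.1, hval t [] ht.2.1 w.1 w.2⟩, (key _).1 ?_, ?_⟩
    · simpa [List.map_map, Function.comp_def] using ht
    · simp [List.map_map, Function.comp_def]

/-- A walk inside the cone of the letter `l` that avoids its apex stays inside this cone. -/
theorem exists_map_cons_of_isChain {l : FreeLetter V o} (t : List (List (FreeLetter V o))) :
    ∀ w : List (FreeLetter V o), w ≠ [] → ((l :: w) :: t).IsChain (wordAdj G o) → [l] ∉ t →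
      ∃ q : List (List (FreeLetter V o)), t = q.map (l :: ·) ∧ (w :: q).IsChain (wordAdj G o) ∧
        ∀ v ∈ q, ∀ k ∈ v.head?, l.1 ≠ k.1 := by
  induction t with
  | nil => exact fun w _ _ _ => ⟨[], by simp⟩
  | cons v t ih =>
    intro w hw h hl
    obtain ⟨hv, ht⟩ := List.isChain_cons_cons.1 h
    rcases hv.cases with ⟨i, x, y, -, hx, -⟩ | ⟨l', a', b', ha, hb, hab, hk⟩
    -- An edge of a copy at the root has ends of length at most one, whereas `l :: w` is longer.
    · have := length_vertexWord_le o x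
      rw [← hx, List.length_cons] at this
      exact absurd (List.length_eq_zero_iff.1 (by omega)) hw
    · obtain ⟨rfl, rfl⟩ := List.cons.inj ha
      subst hb
      have hb' : b' ≠ [] := by rintro rfl; simp at hl
      obtain ⟨q, rfl, hq, hqk⟩ := ih b' hb' ht fun hm => hl (List.mem_cons_of_mem _ hm)
      refine ⟨b' :: q, rfl, List.isChain_cons_cons.2 ⟨hab, hq⟩, ?_⟩
      intro u hu
      rcases List.mem_cons.1 hu with rfl | hu
      · exact hk
      · exact hqk u hu

/-- A self-avoiding walk that starts at the letter `x` of `V i` and avoids the root first moves in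
`V i` and then in the cone of the last visited letter. -/
theorem exists_decomposition {i : ι} (t : List (List (FreeLetter V o))) :
    ∀ x : V i, x ≠ o i → (vertexWord o x :: t).IsChain (wordAdj G o) →
      (vertexWord o x :: t).Nodup → [] ∉ t →
      ∃ (p : List (V i)) (q : List (List (FreeLetter V o))),
        t = p.map (vertexWord o) ++ q.map (vertexWord o (p.getLastD x) ++ ·) ∧
        (x :: p).IsChain (G i).Adj ∧ ([] :: q).IsChain (wordAdj G o) ∧ [] ∉ q ∧
        ∀ v ∈ q, ∀ k ∈ v.head?, i ≠ k.1 := by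
  induction t with
  | nil => exact fun x _ _ _ _ => ⟨[], [], by simp⟩
  | cons v t ih =>
    intro x hx h hd h0
    obtain ⟨hv, ht⟩ := List.isChain_cons_cons.1 h
    have hvx := vertexWord_of_ne o hx
    have ht0 : [] ∉ t := fun hm => h0 (List.mem_cons_of_mem _ hm)
    rcases hv.cases with ⟨j, x', y, hxy, hx', rfl⟩ | ⟨l, a', b', ha, rfl, hab, hk⟩
    · have hxo : x' ≠ o j := by
        rintro rfl
        rw [vertexWord_self, vertexWord_eq_nil] at hx'
        exact hx hx'
      rw [hvx, vertexWord_of_ne o hxo, List.cons.injEq, Sigma.mk.injEq] at hx'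
      obtain ⟨⟨rfl, hx'⟩, -⟩ := hx'
      obtain rfl : x = x' := congrArg Subtype.val (eq_of_heq hx')
      have hy : y ≠ o i := by
        rintro rfl
        exact h0 (by simp [vertexWord_self])
      obtain ⟨p, q, rfl, hp, hq⟩ := ih y hy ht (List.nodup_cons.1 hd).2 ht0
      refine ⟨y :: p, q, ?_, List.isChain_cons_cons.2 ⟨hxy, hp⟩, hq⟩
      rw [List.getLastD_cons]
      rfl
    · rw [hvx] at ha
      obtain ⟨rfl, rfl⟩ := List.cons.inj ha
      -- The walk has entered the cone of `x`; self-avoidance forbids a return to the apex, so the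
      -- rest stays inside.
      obtain ⟨q, rfl, hq, hqk⟩ := exists_map_cons_of_isChain t b' hab.ne.symm ht fun hm => by
        rw [hvx] at hd
        exact (List.nodup_cons.1 hd).1 (List.mem_cons_of_mem _ hm)
      refine ⟨[], b' :: q, by simp [hvx], List.IsChain.singleton _,
        List.isChain_cons_cons.2 ⟨hab, hq⟩, ?_, ?_⟩
      · intro hm
        rcases List.mem_cons.1 hm with hm | hm
        · exact hab.ne hm
        · refine (List.nodup_cons.1 hd).1 (List.mem_cons_of_mem _ (List.mem_map.2 ⟨[], hm, ?_⟩))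
          simp [hvx]
      · intro u hu
        rcases List.mem_cons.1 hu with rfl | hu
        · exact hk
        · exact hqk u hu

/-! ### Unique decomposition of walks by their first factor -/

/-- The self-avoiding walks in the free product whose first step is an edge of `G i`. -/
def sawListsFrom (G : ∀ i, SimpleGraph (V i)) (o : ∀ i, V i) (i : ι) (n : ℕ) :
    Set (List (List (FreeLetter V o))) :=
  {t ∈ sawLists (wordAdj G o) [] n | ∃ (x : V i) (t' : _), t = vertexWord o x :: t'}

/-- The walk that follows `p` in `G i` and then `q` in the cone of the last vertex of `p`. -/
noncomputable def joinSaw (o : ∀ i, V i) (i : ι) (pq : List (V i) × List (List (FreeLetter V o))) :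
    List (List (FreeLetter V o)) :=
  pq.1.map (vertexWord o) ++ pq.2.map (vertexWord o (pq.1.getLastD (o i)) ++ ·)

theorem exists_joinSaw_of_mem_sawListsFrom {i : ι} {n : ℕ} {t : List (List (FreeLetter V o))}
    (ht : t ∈ sawListsFrom G o i n) :
    ∃ (p : List (V i)) (q : List (List (FreeLetter V o))), 1 ≤ p.length ∧
      p.length + q.length = n ∧ p ∈ sawLists (G i).Adj (o i) p.length ∧
      q ∈ sawLists (wordAdj G o) [] q.length ∧ (∀ v ∈ q, ∀ k ∈ v.head?, i ≠ k.1) ∧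
      joinSaw o i (p, q) = t := by
  obtain ⟨⟨rfl, hc, hd⟩, x, t, rfl⟩ := ht
  obtain ⟨h0x, hc'⟩ := List.isChain_cons_cons.1 hc
  obtain ⟨h0, hd'⟩ := List.nodup_cons.1 hd
  have hx : x ≠ o i := by
    rintro rfl
    exact h0 (by simp [vertexWord_self])
  obtain ⟨p, q, rfl, hp, hq, hq0, hqk⟩ := exists_decomposition t x hx hc' hd'
    fun hm => h0 (List.mem_cons_of_mem _ hm)
  have hox : (G i).Adj (o i) x := by
    rcases h0x.cases with ⟨j, x', y, hxy, hx', hy⟩ | ⟨l, a', b', ha, -⟩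
    · obtain rfl := (vertexWord_eq_nil o).1 hx'.symm
      have hyo : y ≠ o j := hxy.ne'
      rw [vertexWord_of_ne o hx, vertexWord_of_ne o hyo, List.cons.injEq, Sigma.mk.injEq] at hy
      obtain ⟨⟨rfl, hy⟩, -⟩ := hy
      obtain rfl : x = y := congrArg Subtype.val (eq_of_heq hy)
      exact hxy
    · simp at ha
  refine ⟨x :: p, q, by simp, by simp; omega, ⟨rfl, List.isChain_cons_cons.2 ⟨hox, hp⟩, ?_⟩,
    ⟨rfl, hq, ?_⟩, hqk, ?_⟩
  · have : ((o i :: x :: p).map (vertexWord o)).Nodup := by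
      refine List.Nodup.sublist ?_ hd
      simp [vertexWord_self]
    exact this.of_map
  · refine List.nodup_cons.2 ⟨hq0, ?_⟩
    rw [List.nodup_cons] at hd'
    exact (List.nodup_append.1 hd'.2).2.1.of_map
  · simp only [joinSaw, List.getLastD_cons, List.map_cons, List.cons_append]

theorem mem_sawListsFrom_of_head {n : ℕ} {v : List (FreeLetter V o)}
    {t : List (List (FreeLetter V o))} (h : v :: t ∈ sawLists (wordAdj G o) [] n) :
    ∃ j, v :: t ∈ sawListsFrom G o j n := by
  obtain ⟨h0, -⟩ := List.isChain_cons_cons.1 h.2.1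
  rcases h0.cases with ⟨j, x', y, -, -, rfl⟩ | ⟨l, a', b', ha, -⟩
  · exact ⟨j, h, y, t, rfl⟩
  · simp at ha

theorem getLastD_ne {i : ι} {p : List (V i)} (hp : 1 ≤ p.length) (h0 : o i ∉ p) :
    p.getLastD (o i) ≠ o i := by
  cases p with
  | nil => simp at hp
  | cons x p =>
    intro h
    have := List.getLastD_mem_cons (l := p) (a := x)
    rw [List.getLastD_cons] at h
    exact h0 (h ▸ this)

/-- The first factor fixes the index of the first letter of every later vertex. This makes the
classes for different `i` disjoint and identifies the walks that may follow a walk in `G i`. -/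
theorem fst_eq_of_mem_sawListsFrom {i : ι} {n : ℕ} {t : List (List (FreeLetter V o))}
    (ht : t ∈ sawListsFrom G o i n) : ∀ v ∈ t, ∀ k ∈ v.head?, k.1 = i := by
  obtain ⟨p, q, h1, -, hp, -, -, rfl⟩ := exists_joinSaw_of_mem_sawListsFrom ht
  have hl := getLastD_ne h1 (List.nodup_cons.1 hp.2.2).1
  intro v hv k hk
  rcases List.mem_append.1 hv with hv | hv
  · obtain ⟨x, -, rfl⟩ := List.mem_map.1 hv
    exact fst_eq_of_mem_vertexWord o (List.mem_of_mem_head? hk)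
  · obtain ⟨w, -, rfl⟩ := List.mem_map.1 hv
    rw [vertexWord_of_ne o hl] at hk
    obtain rfl : _ = k := by simpa using hk
    rfl

theorem ne_fst_of_notMem_sawListsFrom {i : ι} {n : ℕ} {q : List (List (FreeLetter V o))}
    (hq : q ∈ sawLists (wordAdj G o) [] n \ sawListsFrom G o i n) :
    ∀ v ∈ q, ∀ k ∈ v.head?, i ≠ k.1 := by
  cases q with
  | nil => simp
  | cons v q =>
    obtain ⟨j, hj⟩ := mem_sawListsFrom_of_head hq.1
    intro w hw k hk hik
    have := fst_eq_of_mem_sawListsFrom hj w hw k hk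
    rw [← hik] at this
    subst this
    exact hq.2 hj

theorem isChain_map_append {i : ι} {x : V i} (hx : x ≠ o i) (q : List (List (FreeLetter V o)))
    (hq : q.IsChain (wordAdj G o)) (hk : ∀ v ∈ q, ∀ k ∈ v.head?, i ≠ k.1) :
    (q.map (vertexWord o x ++ ·)).IsChain (wordAdj G o) := by
  rw [vertexWord_of_ne o hx]
  induction q with
  | nil => simp
  | cons v q ih =>
    cases q with
    | nil => simp
    | cons w q =>
      obtain ⟨hvw, hq⟩ := List.isChain_cons_cons.1 hq
      refine List.isChain_cons_cons.2 ⟨hvw.cons (hk v (by simp)) (hk w (by simp)), ?_⟩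
      exact ih hq fun u hu => hk u (List.mem_cons_of_mem _ hu)

theorem isChain_joinSaw {i : ι} (p : List (V i)) (q : List (List (FreeLetter V o)))
    (hq : ([] :: q).IsChain (wordAdj G o)) (hk : ∀ v ∈ q, ∀ k ∈ v.head?, i ≠ k.1) :
    ∀ x : V i, (x :: p).IsChain (G i).Adj → p.getLastD x ≠ o i →
      (vertexWord o x :: (p.map (vertexWord o) ++
        q.map (vertexWord o (p.getLastD x) ++ ·))).IsChain (wordAdj G o) := by
  induction p with
  | nil =>
    intro x _ hx
    have := isChain_map_append hx ([] :: q) hq (by simpa using hk)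
    simpa using this
  | cons y p ih =>
    intro x h hl
    obtain ⟨hxy, hp⟩ := List.isChain_cons_cons.1 h
    rw [List.getLastD_cons] at hl ⊢
    exact List.isChain_cons_cons.2 ⟨wordAdj_vertexWord hxy, ih y hp hl⟩

theorem length_le_one_of_mem_map {i : ι} {p : List (V i)} {v : List (FreeLetter V o)}
    (hv : v ∈ p.map (vertexWord o)) : v.length ≤ 1 := by
  obtain ⟨x, -, rfl⟩ := List.mem_map.1 hv
  exact length_vertexWord_le o x

theorem two_le_length_of_mem_map {i : ι} {x : V i} (hx : x ≠ o i)
    {q : List (List (FreeLetter V o))} (hq : [] ∉ q) {v : List (FreeLetter V o)}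
    (hv : v ∈ q.map (vertexWord o x ++ ·)) : 2 ≤ v.length := by
  obtain ⟨w, hw, rfl⟩ := List.mem_map.1 hv
  have : w ≠ [] := by rintro rfl; exact hq hw
  have := List.length_pos_iff.2 this
  rw [vertexWord_of_ne o hx]
  simp
  omega

theorem joinSaw_mem {i : ι} {k m : ℕ} (hk : 1 ≤ k) {p : List (V i)}
    {q : List (List (FreeLetter V o))} (hp : p ∈ sawLists (G i).Adj (o i) k)
    (hq : q ∈ sawLists (wordAdj G o) [] m \ sawListsFrom G o i m) :
    joinSaw o i (p, q) ∈ sawListsFrom G o i (k + m) := by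
  obtain ⟨rfl, hpc, hpd⟩ := hp
  have hqk := ne_fst_of_notMem_sawListsFrom hq
  obtain ⟨⟨rfl, hqc, hqd⟩, -⟩ := hq
  have hl := getLastD_ne hk (List.nodup_cons.1 hpd).1
  refine ⟨⟨by simp [joinSaw], ?_, ?_⟩, ?_⟩
  · have := isChain_joinSaw p q hqc hqk (o i) hpc hl
    rwa [vertexWord_self] at this
  · have h1 : ((o i :: p).map (vertexWord o)).Nodup :=
      hpd.map fun _ _ => vertexWord_injective o
    have h2 : (q.map (vertexWord o (p.getLastD (o i)) ++ ·)).Nodup :=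
      (List.nodup_cons.1 hqd).2.map fun _ _ => List.append_cancel_left
    have := List.nodup_append.2 ⟨h1, h2, fun a ha b hb => by
      rintro rfl
      have := length_le_one_of_mem_map ha
      have := two_le_length_of_mem_map hl (List.nodup_cons.1 hqd).1 hb
      omega⟩
    rwa [List.map_cons, vertexWord_self, List.cons_append] at this
  · cases p with
    | nil => simp at hk
    | cons x p => exact ⟨x, _, rfl⟩

/-- The two pieces can be told apart by word length: vertices from `p` have length at most one,
those from `q` at least two. -/
theorem joinSaw_injective {i : ι} {p p' : List (V i)} {q q' : List (List (FreeLetter V o))}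
    (hp : 1 ≤ p.length) (hp' : 1 ≤ p'.length) (hp0 : o i ∉ p) (hp0' : o i ∉ p')
    (hq : [] ∉ q) (hq' : [] ∉ q') (h : joinSaw o i (p, q) = joinSaw o i (p', q')) :
    p = p' ∧ q = q' := by
  have key : ∀ {p : List (V i)} {q : List (List (FreeLetter V o))}, 1 ≤ p.length → o i ∉ p →
      [] ∉ q → (joinSaw o i (p, q)).filter (fun v => v.length ≤ 1) = p.map (vertexWord o) := by
    intro p q hp hp0 hq
    rw [joinSaw, List.filter_append, List.filter_eq_self.2, List.filter_eq_nil_iff.2,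
      List.append_nil]
    · intro v hv
      have := two_le_length_of_mem_map (getLastD_ne hp hp0) hq hv
      simp
      omega
    · intro v hv
      simpa using length_le_one_of_mem_map hv
  have hpp : p = p' := by
    have h1 := key hp hp0 hq
    rw [h, key hp' hp0' hq'] at h1
    exact (List.map_injective_iff.2 (fun _ _ => vertexWord_injective o) h1).symm
  subst hpp
  refine ⟨rfl, ?_⟩
  have := List.append_cancel_left h
  exact List.map_injective_iff.2 (fun _ _ => List.append_cancel_left) this

/-- The decomposition of the self-avoiding walks that start with an edge of `G i`. -/
theorem sawListsFrom_eq_image (i : ι) (n : ℕ) :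
    sawListsFrom G o i n = joinSaw o i '' ⋃ k ∈ Finset.Icc 1 n,
      sawLists (G i).Adj (o i) k ×ˢ
        (sawLists (wordAdj G o) [] (n - k) \ sawListsFrom G o i (n - k)) := by
  ext t
  simp only [Set.mem_image, Set.mem_iUnion, Finset.mem_Icc, Prod.exists, Set.mem_prod]
  constructor
  · intro ht
    obtain ⟨p, q, h1, h2, hp, hq, hqk, rfl⟩ := exists_joinSaw_of_mem_sawListsFrom ht
    refine ⟨p, q, ⟨p.length, ⟨h1, by omega⟩, hp, ?_⟩, rfl⟩
    have : n - p.length = q.length := by omega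
    rw [this]
    refine ⟨hq, fun hq' => ?_⟩
    obtain ⟨x, q, rfl⟩ := hq'.2
    have hx : x ≠ o i := by
      rintro rfl
      exact (List.nodup_cons.1 hq.2.2).1 (by simp [vertexWord_self])
    exact hqk _ List.mem_cons_self ⟨i, ⟨x, hx⟩⟩ (by simp [vertexWord_of_ne o hx]) rfl
  · rintro ⟨p, q, ⟨k, ⟨hk1, hkn⟩, hp, hq⟩, rfl⟩
    have := joinSaw_mem hk1 hp hq
    rwa [Nat.add_sub_cancel' hkn] at this

theorem injOn_joinSaw (i : ι) (n : ℕ) :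
    Set.InjOn (joinSaw o i) (⋃ k ∈ Finset.Icc 1 n, sawLists (G i).Adj (o i) k ×ˢ
        (sawLists (wordAdj G o) [] (n - k) \ sawListsFrom G o i (n - k))) := by
  rintro ⟨p, q⟩ h ⟨p', q'⟩ h' heq
  simp only [Set.mem_iUnion, Finset.mem_Icc, Set.mem_prod] at h h'
  obtain ⟨k, ⟨hk, -⟩, hp, hq⟩ := h
  obtain ⟨k', ⟨hk', -⟩, hp', hq'⟩ := h'
  obtain ⟨rfl, rfl⟩ := joinSaw_injective (hp.1 ▸ hk) (hp'.1 ▸ hk') (List.nodup_cons.1 hp.2.2).1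
    (List.nodup_cons.1 hp'.2.2).1 (List.nodup_cons.1 hq.1.2.2).1 (List.nodup_cons.1 hq'.1.2.2).1 heq
  rfl

theorem sawListsFrom_subset (i : ι) (n : ℕ) :
    sawListsFrom G o i n ⊆ sawLists (wordAdj G o) [] n := fun _ h => h.1

theorem sawLists_succ_eq_iUnion (n : ℕ) :
    sawLists (wordAdj G o) [] (n + 1) = ⋃ i, sawListsFrom G o i (n + 1) := by
  ext t
  rw [Set.mem_iUnion]
  refine ⟨fun h => ?_, fun ⟨i, h⟩ => h.1⟩
  cases t with
  | nil => simp [sawLists] at h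
  | cons v t => exact mem_sawListsFrom_of_head h

theorem sawListsFrom_zero (i : ι) : sawListsFrom G o i 0 = ∅ := by
  ext t
  simp only [Set.mem_empty_iff_false, iff_false]
  rintro ⟨⟨h, -⟩, x, t, rfl⟩
  simp at h

theorem pairwise_disjoint_sawListsFrom (n : ℕ) :
    Pairwise fun i j => Disjoint (sawListsFrom G o i n) (sawListsFrom G o j n) := by
  intro i j hij
  rw [Set.disjoint_left]
  intro t hi hj
  obtain ⟨x, t, rfl⟩ := hi.2
  have hx : x ≠ o i := by
    rintro rfl
    exact (List.nodup_cons.1 hi.1.2.2).1 (by simp [vertexWord_self])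
  exact hij (fst_eq_of_mem_sawListsFrom hj _ List.mem_cons_self ⟨i, ⟨x, hx⟩⟩
    (by simp [vertexWord_of_ne o hx]))

/-- The decomposition itself gives finiteness by strong induction, since `k ≥ 1`. It is needed
because `Set.ncard` is `0` on infinite sets. -/
theorem wordAdj_sawLists_finite [Finite ι] [∀ i, Finite (V i)] (n : ℕ) :
    (sawLists (wordAdj G o) [] n).Finite := by
  induction n using Nat.strong_induction_on with
  | _ n ih =>
    cases n with
    | zero => rw [sawLists_zero]; exact Set.finite_singleton _
    | succ n =>
      rw [sawLists_succ_eq_iUnion]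
      refine Set.finite_iUnion fun i => ?_
      rw [sawListsFrom_eq_image]
      refine Set.Finite.image _ (Set.Finite.biUnion (Finset.finite_toSet _) fun k hk => ?_)
      have hk' := Finset.mem_Icc.1 (Finset.mem_coe.1 hk)
      exact (sawLists_finite _ _ _).prod ((ih _ (by omega)).sdiff)

theorem ncard_sawLists_succ [Fintype ι] [∀ i, Finite (V i)] (n : ℕ) :
    (sawLists (wordAdj G o) [] (n + 1)).ncard = ∑ i, (sawListsFrom G o i (n + 1)).ncard := by
  rw [sawLists_succ_eq_iUnion, Set.ncard_iUnion_of_finite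
    (fun i => (wordAdj_sawLists_finite (n + 1)).subset (sawListsFrom_subset i _))
    (pairwise_disjoint_sawListsFrom _), finsum_eq_sum_of_fintype]

theorem ncard_sawListsFrom [Finite ι] [∀ i, Finite (V i)] (i : ι) (n : ℕ) :
    (sawListsFrom G o i n).ncard = ∑ k ∈ Finset.Icc 1 n, (sawLists (G i).Adj (o i) k).ncard *
      ((sawLists (wordAdj G o) [] (n - k)).ncard - (sawListsFrom G o i (n - k)).ncard) := by
  have hfin := wordAdj_sawLists_finite (G := G) (o := o)
  rw [sawListsFrom_eq_image, (injOn_joinSaw i n).ncard_image, ← Finset.set_biUnion_coe,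
    (Finset.finite_toSet _).ncard_biUnion, finsum_mem_coe_finset]
  · refine Finset.sum_congr rfl fun k _ => ?_
    rw [Set.ncard_prod, Set.ncard_sdiff (sawListsFrom_subset i _)
      ((hfin _).subset (sawListsFrom_subset i _))]
  · exact fun k _ => (sawLists_finite _ _ _).prod (hfin _).sdiff
  · intro k _ k' _ hkk
    -- The length of the first component recovers `k`.
    refine Set.disjoint_left.2 fun pq h h' => hkk ?_
    exact h.1.1.symm.trans h'.1.1

end FreeWords

/-! ### Growth of solutions of the renewal recurrence -/

section RenewalSystem

variable {ι : Type*} [Fintype ι] {m a : ι → ℕ → ℕ} {σ : ℕ → ℕ} {N : ℕ} {z : ℝ}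

/-- The system of recurrences satisfied by the number `σ n` of concatenations of total length `n` of
blocks, of which there are `m i k` of type `i` and length `k`, with no two consecutive blocks of the
same type, and by the number `a i n` of those that begin with a block of type `i`. -/
structure IsRenewalSystem (m a : ι → ℕ → ℕ) (σ : ℕ → ℕ) : Prop where
  zero : σ 0 = 1
  succ : ∀ n, σ (n + 1) = ∑ i, a i (n + 1)
  start_zero : ∀ i, a i 0 = 0
  start : ∀ i n, a i n = ∑ k ∈ Finset.Icc 1 n, m i k * (σ (n - k) - a i (n - k))

namespace IsRenewalSystem

/-- The empty concatenation starts with no block, whence the extra `1` at `n = 0`. -/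
theorem sub_eq (h : IsRenewalSystem m a σ) [DecidableEq ι] (i : ι) (n : ℕ) :
    ((σ n - a i n : ℕ) : ℝ) =
      (if n = 0 then 1 else 0) + ∑ j ∈ Finset.univ.erase i, (a j n : ℝ) := by
  cases n with
  | zero => simp [h.zero, h.start_zero]
  | succ n =>
    rw [h.succ, ← Finset.add_sum_erase _ _ (Finset.mem_univ i), Nat.add_sub_cancel_left]
    simp

theorem start_mul_pow (h : IsRenewalSystem m a σ) (z : ℝ) (i : ι) (n : ℕ) :
    (a i n : ℝ) * z ^ n =
      ∑ k ∈ Finset.Icc 1 n, (m i k * z ^ k) * (((σ (n - k) - a i (n - k) : ℕ) : ℝ) * z ^ (n - k)) := by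
  conv_lhs => rw [h.start i n]
  push_cast
  rw [Finset.sum_mul]
  refine Finset.sum_congr rfl fun k hk => ?_
  have hpow : z ^ n = z ^ k * z ^ (n - k) := by
    rw [← pow_add, Nat.add_sub_cancel' (Finset.mem_Icc.1 hk).2]
  rw [hpow]
  ring

/-- Blocks of length one whose types alternate between two indices already give one concatenation of
each length. -/
theorem one_le_start (h : IsRenewalSystem m a σ) [Nontrivial ι] (hm : ∀ i, 1 ≤ m i 1) (n : ℕ) :
    ∀ i, 1 ≤ a i (n + 1) := by
  classical
  induction n with
  | zero =>
    intro i
    rw [h.start]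
    simpa [h.zero, h.start_zero] using hm i
  | succ n ih =>
    intro i
    obtain ⟨j, hj⟩ := exists_ne i
    have h1 : 1 ≤ σ (n + 1) - a i (n + 1) := by
      rw [h.succ, ← Finset.add_sum_erase _ _ (Finset.mem_univ i), Nat.add_sub_cancel_left]
      exact (ih j).trans (Finset.single_le_sum (f := fun j => a j (n + 1)) (fun _ _ => Nat.zero_le _)
        (Finset.mem_erase.2 ⟨hj, Finset.mem_univ j⟩))
    rw [h.start]
    refine le_trans ?_ (Finset.single_le_sum (fun _ _ => Nat.zero_le _)
      (Finset.mem_Icc.2 ⟨le_rfl, by omega⟩ : 1 ∈ Finset.Icc 1 (n + 1 + 1)))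
    exact Nat.mul_pos (hm i) h1

/-- The solution of a renewal system grows like `z⁻ⁿ`, where `z` is the zero in `(0, 1]` of the
characteristic equation. -/
theorem exists_bounds (h : IsRenewalSystem m a σ) [Nontrivial ι] (hm : ∀ i, 1 ≤ m i 1)
    (hN : ∀ i k, N < k → m i k = 0) (hz : 0 < z) (hz1 : z ≤ 1) {M : ι → ℝ}
    (hM : ∀ i, M i = ∑ k ∈ Finset.Icc 1 N, m i k * z ^ k) (hroot : ∑ i, M i / (1 + M i) = 1) :
    ∃ c C : ℝ, 0 < c ∧ 0 < C ∧ ∀ n, 1 ≤ n → c ≤ σ n * z ^ n ∧ σ n * z ^ n ≤ C := by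
  classical
  have hM0 : ∀ i, 0 ≤ M i := fun i => by rw [hM]; positivity
  set u : ι → ℝ := fun i => M i / (1 + M i) with hu
  have hu0 : ∀ i, 0 ≤ u i := fun i => div_nonneg (hM0 i) (by linarith [hM0 i])
  have hu1 : ∀ i, 1 - u i = 1 / (1 + M i) := fun i => by
    have := hM0 i
    simp only [hu]; field_simp; ring
  have hMu : ∀ i, M i * (1 - u i) = u i := fun i => by rw [hu1, mul_one_div]
  have hu1' : ∀ i, 0 < 1 - u i := fun i => by
    rw [hu1]; have := hM0 i; positivity
  have herase : ∀ i, ∑ j ∈ Finset.univ.erase i, u j = 1 - u i := fun i => by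
    rw [← hroot, ← Finset.add_sum_erase _ _ (Finset.mem_univ i)]; ring
  set b : ι → ℕ → ℝ := fun i n => ((σ n - a i n : ℕ) : ℝ) * z ^ n with hb
  have hb0 : ∀ i, b i 0 = 1 := fun i => by simp [hb, h.zero, h.start_zero]
  have hbn : ∀ i n, 1 ≤ n → b i n = ∑ j ∈ Finset.univ.erase i, (a j n : ℝ) * z ^ n := by
    intro i n hn
    simp only [hb]
    rw [h.sub_eq, if_neg (by omega), zero_add, Finset.sum_mul]
  have hbnn : ∀ i n, 0 ≤ b i n := fun i n => by positivity
  have ha : ∀ i n, (a i n : ℝ) * z ^ n = ∑ k ∈ Finset.Icc 1 n, (m i k * z ^ k) * b i (n - k) :=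
    fun i n => h.start_mul_pow z i n
  have hσ : ∀ n, 1 ≤ n → (σ n : ℝ) * z ^ n = ∑ i, (a i n : ℝ) * z ^ n := by
    intro n hn
    obtain ⟨n, rfl⟩ := Nat.exists_eq_add_of_le' hn
    rw [h.succ]; push_cast; rw [Finset.sum_mul]
  -- This choice gives `1 ≤ C * (1 - u i)` for all `i`, which covers the exceptional value `b i 0 =
  -- 1` in the upper bound.
  set C : ℝ := ∑ i, (1 + M i) with hC
  have hC1 : ∀ i, 1 ≤ C * (1 - u i) := fun i => by
    have h1 : 1 + M i ≤ C := Finset.single_le_sum (f := fun i => 1 + M i)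
      (fun i _ => by linarith [hM0 i]) (Finset.mem_univ i)
    rw [hu1, mul_one_div, le_div_iff₀ (by linarith [hM0 i])]
    linarith
  have hC0 : 0 ≤ C := Finset.sum_nonneg fun i _ => by linarith [hM0 i]
  have upper : ∀ n i, (a i n : ℝ) * z ^ n ≤ C * u i := by
    intro n
    induction n using Nat.strong_induction_on with
    | _ n ih =>
      intro i
      have hbC : ∀ k ∈ Finset.Icc 1 n, b i (n - k) ≤ C * (1 - u i) := by
        intro k hk
        have hk' := Finset.mem_Icc.1 hk
        rcases Nat.eq_zero_or_pos (n - k) with h0 | h0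
        · rw [h0, hb0]; exact hC1 i
        · rw [hbn _ _ h0, ← herase, Finset.mul_sum]
          exact Finset.sum_le_sum fun j _ => ih _ (by omega) j
      rw [ha]
      calc ∑ k ∈ Finset.Icc 1 n, (m i k * z ^ k) * b i (n - k)
          ≤ ∑ k ∈ Finset.Icc 1 n, (m i k * z ^ k) * (C * (1 - u i)) :=
            Finset.sum_le_sum fun k hk => mul_le_mul_of_nonneg_left (hbC k hk) (by positivity)
        _ = (∑ k ∈ Finset.Icc 1 n, m i k * z ^ k) * (C * (1 - u i)) := (Finset.sum_mul _ _ _).symm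
        _ ≤ M i * (C * (1 - u i)) := by
            refine mul_le_mul_of_nonneg_right ?_ (mul_nonneg hC0 (hu1' i).le)
            rw [hM]
            -- For `n < N` nonnegative terms are missing; for `n ≥ N` the additional terms vanish by
            -- `hN`.
            rcases le_total n N with hnN | hnN
            · exact Finset.sum_le_sum_of_subset_of_nonneg (Finset.Icc_subset_Icc_right hnN)
                fun k _ _ => by positivity
            · refine (Finset.sum_subset (Finset.Icc_subset_Icc_right hnN) fun k hk hkN => ?_).ge
              have h1 := Finset.mem_Icc.1 hk
              rw [hN i k (by_contra fun hlt => hkN (Finset.mem_Icc.2 ⟨h1.1, by omega⟩))]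
              simp
        _ = C * u i := by rw [mul_left_comm, hMu]
  -- The constant `z ^ N` settles the lower bound for `n ≤ N`: there `a i n ≥ 1`, `u i ≤ 1` and `z ^
  -- N ≤ z ^ n`.
  have hc0 : (0 : ℝ) < z ^ N := pow_pos hz N
  have hc1 : z ^ N ≤ 1 := pow_le_one₀ hz.le hz1
  have lower : ∀ n, 1 ≤ n → ∀ i, z ^ N * u i ≤ (a i n : ℝ) * z ^ n := by
    intro n
    induction n using Nat.strong_induction_on with
    | _ n ih =>
      intro hn i
      rcases le_or_gt n N with hnN | hnN
      · have h1 : (1 : ℝ) ≤ a i n := by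
          have := h.one_le_start hm (n - 1) i
          rw [Nat.sub_add_cancel hn] at this
          exact_mod_cast this
        have h2 : z ^ N ≤ z ^ n := pow_le_pow_of_le_one hz.le hz1 hnN
        nlinarith [hu1' i, hu0 i, pow_pos hz n]
      -- For `n > N` all `n - k` with `k ≤ N` are positive, so the induction hypothesis applies and
      -- the full sum `M i` is available.
      · have hbc : ∀ k ∈ Finset.Icc 1 N, z ^ N * (1 - u i) ≤ b i (n - k) := by
          intro k hk
          have hk' := Finset.mem_Icc.1 hk
          rw [hbn _ _ (by omega), ← herase, Finset.mul_sum]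
          exact Finset.sum_le_sum fun j _ => ih _ (by omega) (by omega) j
        rw [ha]
        calc z ^ N * u i = ∑ k ∈ Finset.Icc 1 N, (m i k * z ^ k) * (z ^ N * (1 - u i)) := by
              rw [← Finset.sum_mul, ← hM, mul_left_comm, hMu]
          _ ≤ ∑ k ∈ Finset.Icc 1 N, (m i k * z ^ k) * b i (n - k) :=
              Finset.sum_le_sum fun k hk => mul_le_mul_of_nonneg_left (hbc k hk) (by positivity)
          _ ≤ ∑ k ∈ Finset.Icc 1 n, (m i k * z ^ k) * b i (n - k) :=
              Finset.sum_le_sum_of_subset_of_nonneg (Finset.Icc_subset_Icc_right hnN.le)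
                fun k _ _ => mul_nonneg (by positivity) (hbnn _ _)
  obtain ⟨i₀⟩ := (inferInstance : Nonempty ι)
  refine ⟨z ^ N, C, hc0, ?_, fun n hn => ?_⟩
  · by_contra hneg
    have := hC1 i₀
    nlinarith [hu1' i₀]
  · rw [hσ n hn]
    constructor
    · calc z ^ N = ∑ i, z ^ N * u i := by rw [← Finset.mul_sum, hroot, mul_one]
        _ ≤ _ := Finset.sum_le_sum fun i _ => lower n hn i
    · calc _ ≤ ∑ i, C * u i := Finset.sum_le_sum fun i _ => upper n i
        _ = C := by rw [← Finset.mul_sum, hroot, mul_one]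

end IsRenewalSystem

end RenewalSystem

/-! ### From two-sided bounds to the limit of the roots -/

theorem tendsto_const_rpow_one_div {c : ℝ} (hc : 0 < c) :
    Filter.Tendsto (fun n : ℕ => c ^ ((1 : ℝ) / (n : ℝ))) Filter.atTop (nhds 1) := by
  have := (tendsto_const_nhds (x := c)).rpow tendsto_one_div_atTop_nhds_zero_nat (Or.inl hc.ne')
  simpa using this

theorem tendsto_rpow_one_div_of_bounds {f : ℕ → ℝ} {z c C : ℝ} (hf : ∀ n, 0 ≤ f n) (hz : 0 < z)
    (hc : 0 < c) (hC : 0 < C) (h : ∀ n, 1 ≤ n → c ≤ f n * z ^ n ∧ f n * z ^ n ≤ C) :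
    Filter.Tendsto (fun n : ℕ => f n ^ ((1 : ℝ) / (n : ℝ))) Filter.atTop (nhds (1 / z)) := by
  have h1 : Filter.Tendsto (fun n : ℕ => (f n * z ^ n) ^ ((1 : ℝ) / (n : ℝ))) Filter.atTop
      (nhds 1) := by
    refine tendsto_of_tendsto_of_tendsto_of_le_of_le' (tendsto_const_rpow_one_div hc)
      (tendsto_const_rpow_one_div hC) ?_ ?_ <;>
    filter_upwards [Filter.eventually_ge_atTop 1] with n hn
    · exact Real.rpow_le_rpow hc.le (h n hn).1 (by positivity)
    · exact Real.rpow_le_rpow (hc.le.trans (h n hn).1) (h n hn).2 (by positivity)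
  refine (h1.div_const z).congr' ?_
  filter_upwards [Filter.eventually_ge_atTop 1] with n hn
  rw [Real.mul_rpow (hf n) (by positivity), one_div, Real.pow_rpow_inv_natCast hz.le (by omega),
    mul_div_cancel_right₀ _ hz.ne']

/-! ### Generating polynomials of the finite factors -/

theorem sawCount_eq_zero {α : Type*} [Finite α] (G : SimpleGraph α) (o : α) {n : ℕ}
    (hn : Nat.card α < n) : sawCount G o n = 0 := by
  have := Fintype.ofFinite α
  rw [sawCount_eq_ncard, Set.ncard_eq_zero (sawLists_finite _ _ _), Set.eq_empty_iff_forall_notMem]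
  rintro t ⟨rfl, -, hd⟩
  have := (List.nodup_cons.1 hd).2.length_le_card
  rw [← Nat.card_eq_fintype_card] at this
  omega

theorem one_le_sawCount_one {α : Type*} [Finite α] [Nontrivial α] {G : SimpleGraph α}
    (hG : G.Connected) (o : α) : 1 ≤ sawCount G o 1 := by
  rw [sawCount_eq_ncard, Nat.succ_le_iff, Set.ncard_pos (sawLists_finite _ _ _)]
  obtain ⟨x, hx⟩ := hG.preconnected.exists_adj_of_nontrivial o
  exact ⟨[x], by simp, by simpa using hx, by simpa using hx.ne⟩

/-- The generating function of the self-avoiding walks of length between `1` and `N`. -/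
noncomputable def sawPoly {α : Type*} (G : SimpleGraph α) (o : α) (N : ℕ) : Polynomial ℤ :=
  ∑ k ∈ Finset.Icc 1 N, Polynomial.monomial k (sawCount G o k : ℤ)

theorem coe_sawPoly {α : Type*} [Finite α] (G : SimpleGraph α) (o : α) {N : ℕ}
    (hN : Nat.card α ≤ N) : (sawPoly G o N : PowerSeries ℤ) = sawSeries G o := by
  ext n
  rw [Polynomial.coeff_coe, sawPoly, Polynomial.finsetSum_coeff, sawSeries, PowerSeries.coeff_mk]
  simp only [Polynomial.coeff_monomial, Finset.sum_ite_eq', Finset.mem_Icc]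
  by_cases h0 : n = 0
  · simp [h0]
  · by_cases hn : n ≤ N
    · rw [if_pos ⟨by omega, hn⟩, if_neg h0]
    · rw [if_neg (by omega), if_neg h0, sawCount_eq_zero G o (by omega), Nat.cast_zero]

theorem aeval_sawPoly {α : Type*} (G : SimpleGraph α) (o : α) (N : ℕ) (t : ℝ) :
    Polynomial.aeval t (sawPoly G o N) = ∑ k ∈ Finset.Icc 1 N, (sawCount G o k : ℝ) * t ^ k := by
  simp [sawPoly, map_sum, Polynomial.aeval_monomial]

theorem aeval_denomPoly {ι : Type*} [Fintype ι] [DecidableEq ι] (M : ι → Polynomial ℤ) (t : ℝ)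
    (h : ∀ i, 1 + Polynomial.aeval t (M i) ≠ 0) :
    Polynomial.aeval t (denomPoly M) = (∏ i, (1 + Polynomial.aeval t (M i))) *
      (1 - ∑ i, Polynomial.aeval t (M i) / (1 + Polynomial.aeval t (M i))) := by
  simp only [denomPoly, map_sub, map_sum, map_mul, map_prod, map_add, map_one]
  rw [mul_sub, mul_one, Finset.mul_sum]
  congr 1
  refine Finset.sum_congr rfl fun i _ => ?_
  rw [← Finset.mul_prod_erase _ _ (Finset.mem_univ i)]
  field_simp [h i]

theorem div_one_add_lt {x y : ℝ} (hx : 0 ≤ x) (hxy : x < y) : x / (1 + x) < y / (1 + y) := by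
  rw [div_lt_div_iff₀ (by linarith) (by linarith)]
  linarith

/-- The number of self-avoiding walks of the free product as a solution of a renewal system. -/
theorem isRenewalSystem_freeProductGraph {ι : Type*} [Fintype ι] {V : ι → Type*}
    [∀ i, Finite (V i)] (G : ∀ i, SimpleGraph (V i)) (o : ∀ i, V i) :
    IsRenewalSystem (fun i k => sawCount (G i) (o i) k) (fun i n => (sawListsFrom G o i n).ncard)
      (sawCount (freeProductGraph G o) (FreeWord.root V o)) where
  zero := by rw [sawCount_freeProductGraph, sawLists_zero, Set.ncard_singleton]
  succ n := by rw [sawCount_freeProductGraph, ncard_sawLists_succ]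
  start_zero i := by rw [sawListsFrom_zero, Set.ncard_empty]
  start i n := by
    simp only [sawCount_freeProductGraph, sawCount_eq_ncard (G i)]
    exact ncard_sawListsFrom (G := G) (o := o) i n

/-! ### The smallest positive zero of the characteristic polynomial -/

section CharacteristicEquation

variable {ι : Type*} [Fintype ι] [DecidableEq ι] {M : ι → Polynomial ℤ}

/-- The characteristic polynomial has a smallest positive zero, it lies in `(0, 1]`, and it solves
the characteristic equation. -/
theorem exists_isLeast_denomPoly [Nontrivial ι]
    (hmono : ∀ i, StrictMonoOn (fun t : ℝ => Polynomial.aeval t (M i)) (Set.Ici 0))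
    (h0 : ∀ i, Polynomial.aeval (0 : ℝ) (M i) = 0) (h1 : ∀ i, 1 ≤ Polynomial.aeval (1 : ℝ) (M i)) :
    ∃ z : ℝ, 0 < z ∧ z ≤ 1 ∧
      IsLeast {t : ℝ | 0 < t ∧ Polynomial.aeval t (denomPoly M) = 0} z ∧
      ∑ i, Polynomial.aeval z (M i) / (1 + Polynomial.aeval z (M i)) = 1 := by
  have hnn : ∀ i (t : ℝ), 0 ≤ t → 0 ≤ Polynomial.aeval t (M i) := fun i t ht => by
    have := (hmono i).monotoneOn Set.self_mem_Ici (Set.mem_Ici.2 ht) ht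
    simpa only [h0] using this
  have hne : ∀ i (t : ℝ), 0 ≤ t → 1 + Polynomial.aeval t (M i) ≠ 0 := fun i t ht => by
    have := hnn i t ht
    positivity
  set H : ℝ → ℝ := fun t => ∑ i, Polynomial.aeval t (M i) / (1 + Polynomial.aeval t (M i)) with hH
  have hcont : ContinuousOn H (Set.Icc 0 1) := by
    refine continuousOn_finsetSum _ fun i _ => ?_
    have hc : Continuous fun t : ℝ => Polynomial.aeval t (M i) := (M i).continuous_aeval
    exact hc.continuousOn.div (continuous_const.add hc).continuousOn fun t ht => hne i t ht.1
  have hH0 : H 0 = 0 := by simp [hH, h0]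
  have hH1 : 1 ≤ H 1 := by
    -- Each summand is at least `1 / 2` at `t = 1`, and there are at least two of them.
    have h2 : ∀ i, (1 / 2 : ℝ) ≤
        Polynomial.aeval (1 : ℝ) (M i) / (1 + Polynomial.aeval (1 : ℝ) (M i)) := fun i => by
      have := h1 i
      rw [div_le_div_iff₀ (by norm_num) (by linarith)]
      linarith
    have h3 : (2 : ℝ) ≤ Fintype.card ι := by exact_mod_cast Fintype.one_lt_card (α := ι)
    calc (1 : ℝ) ≤ ∑ _i : ι, (1 / 2 : ℝ) := by
          rw [Finset.sum_const, Finset.card_univ, nsmul_eq_mul]; linarith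
      _ ≤ H 1 := Finset.sum_le_sum fun i _ => h2 i
  obtain ⟨z, ⟨hz0, hz1⟩, hz⟩ : (1 : ℝ) ∈ H '' Set.Icc 0 1 :=
    intermediate_value_Icc zero_le_one hcont ⟨by rw [hH0]; exact zero_le_one, hH1⟩
  have hzpos : 0 < z := by
    refine lt_of_le_of_ne hz0 ?_
    rintro rfl
    rw [hH0] at hz
    exact zero_ne_one hz
  refine ⟨z, hzpos, hz1, ⟨⟨hzpos, ?_⟩, ?_⟩, hz⟩
  · rw [aeval_denomPoly M z fun i => hne i z hz0]
    have : ∑ i, Polynomial.aeval z (M i) / (1 + Polynomial.aeval z (M i)) = 1 := hz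
    rw [this, sub_self, mul_zero]
  -- A smaller positive zero would also solve `H t = 1`, against the strict monotonicity of `H`.
  · rintro t ⟨ht0, ht⟩
    by_contra! htz
    rw [aeval_denomPoly M t fun i => hne i t ht0.le, mul_eq_zero, sub_eq_zero] at ht
    rcases ht with ht | ht
    · obtain ⟨i, -, hi⟩ := Finset.prod_eq_zero_iff.1 ht
      exact hne i t ht0.le hi
    · have : H t < H z := Finset.sum_lt_sum_of_nonempty Finset.univ_nonempty fun i _ =>
        div_one_add_lt (hnn i t ht0.le) (hmono i (Set.mem_Ici.2 ht0.le) (Set.mem_Ici.2 hz0) htz)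
      rw [hz] at this
      exact absurd ht.symm this.ne

theorem isAlgebraic_of_aeval_denomPoly (h0 : ∀ i, Polynomial.aeval (0 : ℝ) (M i) = 0) {z : ℝ}
    (hz : Polynomial.aeval z (denomPoly M) = 0) : IsAlgebraic ℚ z := by
  -- The value at `0` is `1`.
  have hne : denomPoly M ≠ 0 := by
    intro h
    have h1 := aeval_denomPoly M 0 fun i => by rw [h0]; norm_num
    simp [h, h0] at h1
  exact (IsFractionRing.isAlgebraic_iff ℤ ℚ ℝ).1 ⟨denomPoly M, hne, hz⟩

end CharacteristicEquation

theorem strictMonoOn_aeval_sawPoly {α : Type*} {G : SimpleGraph α} {o : α} {N : ℕ} (hN : 1 ≤ N)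
    (h1 : 1 ≤ sawCount G o 1) :
    StrictMonoOn (fun t : ℝ => Polynomial.aeval t (sawPoly G o N)) (Set.Ici 0) := by
  intro s hs t _ hst
  have hs' : 0 ≤ s := hs
  simp only [aeval_sawPoly]
  refine Finset.sum_lt_sum (fun k _ => by gcongr) ⟨1, Finset.mem_Icc.2 ⟨le_rfl, hN⟩, ?_⟩
  have : (0 : ℝ) < sawCount G o 1 := by exact_mod_cast h1
  simpa using mul_lt_mul_of_pos_left hst this

theorem one_le_aeval_sawPoly {α : Type*} {G : SimpleGraph α} {o : α} {N : ℕ} (hN : 1 ≤ N)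
    (h1 : 1 ≤ sawCount G o 1) : 1 ≤ Polynomial.aeval (1 : ℝ) (sawPoly G o N) := by
  simp only [aeval_sawPoly, one_pow, mul_one]
  have h2 : (1 : ℝ) ≤ sawCount G o 1 := by exact_mod_cast h1
  exact h2.trans (Finset.single_le_sum (f := fun k => (sawCount G o k : ℝ))
    (fun _ _ => Nat.cast_nonneg _) (Finset.mem_Icc.2 ⟨le_rfl, hN⟩))

theorem aeval_zero_sawPoly {α : Type*} (G : SimpleGraph α) (o : α) (N : ℕ) :
    Polynomial.aeval (0 : ℝ) (sawPoly G o N) = 0 := by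
  rw [aeval_sawPoly]
  refine Finset.sum_eq_zero fun k hk => ?_
  rw [zero_pow (by have := (Finset.mem_Icc.1 hk).1; omega), mul_zero]

/-! ### The connective constant -/

theorem corollary3p3 {r : ℕ} (hr : 2 ≤ r) {V : Fin r → Type*} [∀ i, Finite (V i)]
    [∀ i, Nontrivial (V i)] (G : ∀ i, SimpleGraph (V i)) (o : ∀ i, V i)
    (hG : ∀ i, (G i).Connected) :
    ∃ (M : Fin r → Polynomial ℤ) (z μ : ℝ),
      (∀ i, (M i : PowerSeries ℤ) = sawSeries (G i) (o i)) ∧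
      IsLeast {t : ℝ | 0 < t ∧ Polynomial.aeval t (denomPoly M) = 0} z ∧
      IsConnectiveConstant (freeProductGraph G o) (FreeWord.root V o) μ ∧
      μ = 1 / z ∧
      IsAlgebraic ℚ μ := by
  have : Nontrivial (Fin r) := Fin.nontrivial_iff_two_le.2 hr
  -- A common degree bound for all factors, as `exists_bounds` uses a single `N`.
  set N : ℕ := ∑ i, Nat.card (V i) with hN
  have hcard : ∀ i, Nat.card (V i) ≤ N := fun i =>
    Finset.single_le_sum (f := fun i => Nat.card (V i)) (fun _ _ => Nat.zero_le _)
      (Finset.mem_univ i)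
  have hN1 : 1 ≤ N := Nat.card_pos.trans_le (hcard ⟨0, by omega⟩)
  have hone : ∀ i, 1 ≤ sawCount (G i) (o i) 1 := fun i => one_le_sawCount_one (hG i) (o i)
  obtain ⟨z, hz0, hz1, hleast, hroot⟩ :=
    exists_isLeast_denomPoly (M := fun i => sawPoly (G i) (o i) N)
      (fun i => strictMonoOn_aeval_sawPoly hN1 (hone i)) (fun i => aeval_zero_sawPoly _ _ _)
      (fun i => one_le_aeval_sawPoly hN1 (hone i))
  obtain ⟨c, C, hc, hC, hbounds⟩ := (isRenewalSystem_freeProductGraph G o).exists_bounds hone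
    (fun i k hk => sawCount_eq_zero _ _ ((hcard i).trans_lt hk)) hz0 hz1
    (fun i => aeval_sawPoly (G i) (o i) N z) hroot
  refine ⟨fun i => sawPoly (G i) (o i) N, z, 1 / z, fun i => coe_sawPoly _ _ (hcard i), hleast,
    tendsto_rpow_one_div_of_bounds (fun n => Nat.cast_nonneg _) hz0 hc hC hbounds, rfl, ?_⟩
  rw [one_div]
  exact (isAlgebraic_of_aeval_denomPoly (fun i => aeval_zero_sawPoly _ _ _) hleast.1.2).inv
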